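/- Let $G$ be a finite simple graph on $n$ vertices whose edges are colored arbitrarily (adjacent edges may have the same color). For a vertex $v$ let the color degree $d^c(v)$ be the number of distinct colors appearing on the edges incident to $v$. A rainbow triangle is a triangle of $G$ whose three edges have pairwise distinct colors. If $$\sum_{v\in V(G)} d^c(v)=\frac{n(n+1)}{2}-1$$ and $G$ contains no rainbow triangle, then $G$ is a complete graph. Moreover, its vertices can be labeled $v_1,\dots,v_n$ and the colors appearing on its edges can be relabeled bijectively by $1,\dots,n-1$, so that the edge $v_iv_j$ has color $i$ for all $1\le i<j\le n$. -/

import Mathlib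

namespace EdgeColored

/-- The color degree of `v`: the number of colors appearing on the edges of `G` incident to `v`.
An `EdgeLabeling` is an arbitrary assignment of colors to the edges of `G` (incident edges may
share a color). -/
noncomputable def colorDegree {V K : Type*} {G : SimpleGraph V} (c : G.EdgeLabeling K)
    (v : V) : ℕ :=
  {k : K | ∃ (w : V) (h : G.Adj v w), c.get v w h = k}.ncard

/-- `G` contains a rainbow triangle: three pairwise adjacent vertices whose three edges have
pairwise distinct colors. -/
def HasRainbowTriangle {V K : Type*} {G : SimpleGraph V} (c : G.EdgeLabeling K) : Prop :=
  ∃ (x y z : V) (hxy : G.Adj x y) (hyz : G.Adj y z) (hxz : G.Adj x z),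
    c.get x y hxy ≠ c.get y z hyz ∧ c.get x y hxy ≠ c.get x z hxz ∧
      c.get y z hyz ≠ c.get x z hxz

end EdgeColored

namespace EdgeColored

open Finset Classical

/-! Induct on the number of vertices. Deleting `v` costs at most its color degree plus one for each
private neighbor, so a vertex where this cost is at most `S.card` gives the bound `n(n+1)/2 - 1` on
the color degree sum (`sum_card_colors_le`). Such a vertex exists
(`exists_card_colors_add_card_privateNbrs_le`) because private neighbors joined to `v` by different
colors are non-adjacent, so a vertex with many saturated colors has private neighbors of small
degree. Equality in the bound forces equality at every deletion, and `IsNested.of_erase` then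
inserts `v` into the ranking of the other vertices. -/

/-- No triangle of the partial edge coloring `col` is rainbow; `none` marks a non-edge. -/
def RainbowFree {V K : Type*} (col : V → V → Option K) : Prop :=
  ∀ x y z, col x y ≠ none → col y z ≠ none → col x z ≠ none →
    col x y = col y z ∨ col x y = col x z ∨ col y z = col x z

/-- The neighbors of `v` in `S`. -/
noncomputable def nbrs {V K : Type*} (col : V → V → Option K) (S : Finset V) (v : V) : Finset V :=
  S.filter fun u => col v u ≠ none

/-- The colors at `v` in the subgraph induced by `S`. -/
noncomputable def colors {V K : Type*} (col : V → V → Option K) (S : Finset V) (v : V) :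
    Finset (Option K) :=
  (nbrs col S v).image (col v)

/-- The neighbors `u` of `v` for which `v` is the only neighbor joined to `u` by the color
of `uv`. -/
noncomputable def privateNbrs {V K : Type*} (col : V → V → Option K) (S : Finset V) (v : V) :
    Finset V :=
  (nbrs col S v).filter fun u => ∀ w ∈ S, col u w = col u v → w = v

/-- The colors at `v` that appear only on edges to private neighbors. -/
noncomputable def saturated {V K : Type*} (col : V → V → Option K) (S : Finset V) (v : V) :
    Finset (Option K) :=
  colors col S v \ (nbrs col S v \ privateNbrs col S v).image (col v)

/-- The vertices of `S` can be ranked so that every pair of vertices is joined by an edge whose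
color is determined by the lower end, different lower ends giving different colors. -/
def IsNested {V K : Type*} (col : V → V → Option K) (S : Finset V) : Prop :=
  ∃ (r : V → ℕ) (κ : V → Option K), Set.InjOn r S ∧
    (∀ u ∈ S, ∀ w ∈ S, r u < r w → col u w = κ u ∧ κ u ≠ none) ∧
    ∀ u ∈ S, ∀ w ∈ S, ∀ u' ∈ S, ∀ w' ∈ S, r u < r w → r u' < r w' → κ u = κ u' → u = u'

/-! ### Private neighbors and saturated colors -/

section

variable {V K : Type*} {col : V → V → Option K}

theorem mem_nbrs {S : Finset V} {u v : V} : u ∈ nbrs col S v ↔ u ∈ S ∧ col v u ≠ none := by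
  simp [nbrs]

theorem mem_privateNbrs {S : Finset V} {u v : V} : u ∈ privateNbrs col S v ↔
    u ∈ nbrs col S v ∧ ∀ w ∈ S, col u w = col u v → w = v := by
  simp [privateNbrs]

theorem privateNbrs_subset (S : Finset V) (v : V) : privateNbrs col S v ⊆ nbrs col S v :=
  filter_subset _ _

theorem nbrs_subset (hd : ∀ v, col v v = none) (S : Finset V) (v : V) :
    nbrs col S v ⊆ S.erase v := by
  intro u hu
  rw [mem_nbrs] at hu
  refine mem_erase.2 ⟨?_, hu.1⟩
  rintro rfl
  exact hu.2 (hd _)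

theorem exists_privateNbr_of_mem_saturated {S : Finset V} {v : V} {k : Option K}
    (hk : k ∈ saturated col S v) : ∃ u ∈ privateNbrs col S v, col v u = k := by
  simp only [saturated, colors, mem_sdiff, mem_image, not_exists, not_and] at hk
  obtain ⟨⟨u, hu, rfl⟩, h⟩ := hk
  refine ⟨u, ?_, rfl⟩
  by_contra hn
  exact h u ⟨hu, hn⟩ rfl

theorem card_colors_le (S : Finset V) (v : V) : (colors col S v).card ≤
    (saturated col S v).card + ((nbrs col S v \ privateNbrs col S v).image (col v)).card := by
  have := le_card_sdiff ((nbrs col S v \ privateNbrs col S v).image (col v)) (colors col S v)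
  unfold saturated
  omega

theorem card_sdiff_privateNbrs (S : Finset V) (v : V) :
    (nbrs col S v \ privateNbrs col S v).card + (privateNbrs col S v).card =
      (nbrs col S v).card :=
  card_sdiff_add_card_eq_card (privateNbrs_subset S v)

theorem card_colors_add_card_privateNbrs_le (S : Finset V) (v : V) :
    (colors col S v).card + (privateNbrs col S v).card ≤
      (saturated col S v).card + (nbrs col S v).card := by
  have h1 := card_colors_le (col := col) S v
  have h2 := card_sdiff_privateNbrs (col := col) S v
  have h3 : ((nbrs col S v \ privateNbrs col S v).image (col v)).card ≤ _ := card_image_le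
  omega

/-- Private neighbors joined to `v` by different colors are not adjacent. -/
theorem col_eq_of_privateNbrs (hs : ∀ u v, col u v = col v u) (hr : RainbowFree col)
    {S : Finset V} {v u w : V} (hvv : col v v = none) (hu : u ∈ privateNbrs col S v)
    (hw : w ∈ privateNbrs col S v) (huw : col u w ≠ none) : col v u = col v w := by
  rw [mem_privateNbrs, mem_nbrs] at hu hw
  obtain ⟨⟨huS, hvu⟩, hu⟩ := hu
  obtain ⟨⟨hwS, hvw⟩, hw⟩ := hw
  rcases hr v u w hvu huw hvw with h | h | h
  · exact absurd (hu w hwS (by rw [← h, hs])) (by rintro rfl; exact hvw hvv)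
  · exact h
  · exact absurd (hw u huS (by rw [hs w u, h, hs])) (by rintro rfl; exact hvu hvv)

/-- Take `v` with the most saturated colors, say `s`, and one private neighbor `f k` per saturated
color `k`. These are pairwise non-adjacent, so each has degree at most `S.card - s` and at most `s`
saturated colors. If the claim failed everywhere, these two counts would sum to more than `S.card`.
-/
theorem exists_card_colors_add_card_privateNbrs_le (hd : ∀ v, col v v = none)
    (hs : ∀ u v, col u v = col v u) (hr : RainbowFree col) {S : Finset V} (hS : S.Nonempty) :
    ∃ v ∈ S, (colors col S v).card + (privateNbrs col S v).card ≤ S.card := by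
  by_contra! hcon
  obtain ⟨v, hv, hmax⟩ := exists_max_image S (fun v => (saturated col S v).card) hS
  have hlt : ∀ u ∈ S, S.card < (saturated col S u).card + (nbrs col S u).card := fun u hu =>
    (hcon u hu).trans_le (card_colors_add_card_privateNbrs_le S u)
  have : Nonempty V := ⟨v⟩
  choose! f hf hfk using fun k (hk : k ∈ saturated col S v) => exists_privateNbr_of_mem_saturated hk
  have hpos : (saturated col S v).Nonempty := by
    rw [← card_pos]
    have h1 := hlt v hv
    have h2 := card_le_card (nbrs_subset hd S v)
    have h3 := card_erase_le (s := S) (a := v)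
    omega
  obtain ⟨k, hk⟩ := hpos
  have hfi : Set.InjOn f (saturated col S v) := fun a ha b hb hab => by
    rw [← hfk a ha, ← hfk b hb, hab]
  have hmem : ∀ k ∈ saturated col S v, f k ∈ S := fun k hk =>
    (mem_nbrs.1 (privateNbrs_subset _ _ (hf k hk))).1
  have hsub : nbrs col S (f k) ⊆ S \ (saturated col S v).image f := by
    intro w hw
    rw [mem_nbrs] at hw
    refine mem_sdiff.2 ⟨hw.1, fun hwi => ?_⟩
    obtain ⟨l, hl, rfl⟩ := mem_image.1 hwi
    have := col_eq_of_privateNbrs hs hr (hd v) (hf k hk) (hf l hl) hw.2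
    rw [hfk k hk, hfk l hl] at this
    subst this
    exact hw.2 (hd _)
  have h1 := card_le_card hsub
  have h2 : (saturated col S v).image f ⊆ S := image_subset_iff.2 hmem
  rw [card_sdiff_of_subset h2, card_image_of_injOn hfi] at h1
  have h3 := card_le_card h2
  rw [card_image_of_injOn hfi] at h3
  have h4 := hlt _ (hmem k hk)
  have h5 := hmax _ (hmem k hk)
  omega

/-! ### Deleting a vertex -/

theorem card_colors_le_erase (hs : ∀ u v, col u v = col v u) {S : Finset V} {v u : V}
    (hu : u ∈ S) : (colors col S u).card ≤
      (colors col (S.erase v) u).card + if u ∈ privateNbrs col S v then 1 else 0 := by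
  split_ifs with h
  · refine (card_le_card ?_).trans (card_insert_le (col u v) _)
    intro k hk
    obtain ⟨w, hw, rfl⟩ := mem_image.1 hk
    rw [mem_nbrs] at hw
    by_cases hwv : w = v
    · simp [hwv]
    · exact mem_insert_of_mem (mem_image_of_mem _ (mem_nbrs.2 ⟨mem_erase.2 ⟨hwv, hw.1⟩, hw.2⟩))
  · refine card_le_card ?_
    intro k hk
    obtain ⟨w, hw, rfl⟩ := mem_image.1 hk
    rw [mem_nbrs] at hw
    by_cases hwv : w = v
    · subst hwv
      simp only [mem_privateNbrs, mem_nbrs, not_and, not_forall] at h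
      obtain ⟨x, hx, hxu, hxw⟩ := h ⟨hu, by rw [hs]; exact hw.2⟩
      exact mem_image.2 ⟨x, mem_nbrs.2 ⟨mem_erase.2 ⟨hxw, hx⟩, by rw [hxu]; exact hw.2⟩, hxu⟩
    · exact mem_image_of_mem _ (mem_nbrs.2 ⟨mem_erase.2 ⟨hwv, hw.1⟩, hw.2⟩)

theorem sum_card_colors_le (hd : ∀ v, col v v = none) (hs : ∀ u v, col u v = col v u)
    {S : Finset V} {v : V} (hv : v ∈ S) : ∑ u ∈ S, (colors col S u).card ≤
      ∑ u ∈ S.erase v, (colors col (S.erase v) u).card +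
        ((colors col S v).card + (privateNbrs col S v).card) := by
  rw [← sum_erase_add S _ hv]
  have h1 := sum_le_sum fun u (hu : u ∈ S.erase v) =>
    card_colors_le_erase (v := v) hs (mem_of_mem_erase hu)
  rw [sum_add_distrib, ← card_filter,
    filter_mem_eq_inter, inter_eq_right.2 ((privateNbrs_subset S v).trans (nbrs_subset hd S v))]
    at h1
  omega

/-- The rest is complete, so all private neighbors (the set `T`) see `v` in one color. The new
ranking puts the vertices outside `T` in their old order, then `v`, then `T` in its old order. -/
theorem IsNested.of_erase (hd : ∀ v, col v v = none) (hs : ∀ u v, col u v = col v u)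
    (hr : RainbowFree col) {S : Finset V} {v : V} (hv : v ∈ S) (h : IsNested col (S.erase v))
    (hcard : S.card ≤ (colors col S v).card + (privateNbrs col S v).card) : IsNested col S := by
  obtain ⟨r, κ, hri, hc, hκ⟩ := h
  have hcomp : ∀ u ∈ S.erase v, ∀ w ∈ S.erase v, u ≠ w → col u w ≠ none := by
    intro u hu w hw huw
    rcases lt_or_gt_of_ne (fun h => huw (hri hu hw h)) with h | h
    · rw [(hc u hu w hw h).1]; exact (hc u hu w hw h).2
    · rw [hs, (hc w hw u hu h).1]; exact (hc w hw u hu h).2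
  have hNsub := nbrs_subset hd S v
  have hmono : ∀ u ∈ privateNbrs col S v, ∀ w ∈ privateNbrs col S v, col v u = col v w := by
    intro u hu w hw
    by_cases huw : u = w
    · rw [huw]
    · exact col_eq_of_privateNbrs hs hr (hd v) hu hw (hcomp u (hNsub (privateNbrs_subset _ _ hu)) w
        (hNsub (privateNbrs_subset _ _ hw)) huw)
  have hsat : (saturated col S v).card ≤ 1 := by
    refine card_le_one.2 fun a ha b hb => ?_
    obtain ⟨u, hu, rfl⟩ := exists_privateNbr_of_mem_saturated ha
    obtain ⟨w, hw, rfl⟩ := exists_privateNbr_of_mem_saturated hb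
    exact hmono u hu w hw
  have h1 := card_colors_le (col := col) S v
  have h2 := card_sdiff_privateNbrs (col := col) S v
  have h3 : ((nbrs col S v \ privateNbrs col S v).image (col v)).card ≤ _ := card_image_le
  have h4 := card_le_card hNsub
  have h5 := card_erase_add_one hv
  -- No slack remains: `S.card` is at most the saturated count plus the image plus the private
  -- neighbors, hence at most `1 + (nbrs col S v).card`, which is at most `S.card`.
  have hN : nbrs col S v = S.erase v := eq_of_subset_of_card_le hNsub (by omega)
  have hinj : Set.InjOn (col v) (nbrs col S v \ privateNbrs col S v : Finset V) :=
    card_image_iff.1 (by omega)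
  obtain ⟨s, hss⟩ := card_pos.1 (show 0 < (saturated col S v).card by omega)
  obtain ⟨t, ht, rfl⟩ := exists_privateNbr_of_mem_saturated hss
  set T := privateNbrs col S v with hT
  have hTs : ∀ a ∈ T, col v a = col v t := fun a ha => hmono a ha t ht
  have hTsub : ∀ a ∈ T, a ∈ S.erase v := fun a ha => hNsub (privateNbrs_subset _ _ ha)
  have hpriv : ∀ a ∈ T, ∀ w ∈ S.erase v, col a w ≠ col v t := by
    intro a ha w hw h
    have := (mem_privateNbrs.1 ha).2 w (mem_of_mem_erase hw) (by rw [h, hs a v, hTs a ha])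
    exact (ne_of_mem_erase hw) this
  have hP : ∀ i ∈ S.erase v, i ∉ T → i ∈ nbrs col S v \ T := fun i hi hiT =>
    mem_sdiff.2 ⟨hN ▸ hi, hiT⟩
  have hPne : ∀ i ∈ S.erase v, i ∉ T → col v i ≠ col v t := by
    intro i hi hiT h
    exact (mem_sdiff.1 hss).2 (mem_image.2 ⟨i, hP i hi hiT, h⟩)
  have hPinj : ∀ i ∈ S.erase v, i ∉ T → ∀ j ∈ S.erase v, j ∉ T → col v i = col v j → i = j :=
    fun i hi hiT j hj hjT h => hinj (hP i hi hiT) (hP j hj hjT) h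
  have hadj : ∀ i ∈ S.erase v, col v i ≠ none := fun i hi => (mem_nbrs.1 (hN ▸ hi)).2
  have hPT : ∀ i ∈ S.erase v, i ∉ T → ∀ a ∈ T, col i a = col v i := by
    intro i hi hiT a ha
    have hia : i ≠ a := fun h => hiT (h ▸ ha)
    rcases hr v i a (hadj i hi) (hcomp i hi a (hTsub a ha) hia) (hadj a (hTsub a ha)) with h | h | h
    · exact h.symm
    · exact absurd (h.trans (hTs a ha)) (hPne i hi hiT)
    · exact absurd (by rw [hs a i, h, hTs a ha]) (hpriv a ha i hi)
  have hPκ : ∀ i ∈ S.erase v, i ∉ T → ∀ j ∈ S.erase v, j ∉ T → r i < r j → κ i = col v i := by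
    intro i hi hiT j hj hjT hij
    have hit : i ≠ t := fun h => hiT (h ▸ ht)
    rcases lt_or_gt_of_ne (fun h => hit (hri hi (hTsub t ht) h)) with h | h
    · rw [← hPT i hi hiT t ht, (hc i hi t (hTsub t ht) h).1]
    -- If `t` were below `i`, the edges `ti` and `tj` would share the color `κ t`, so `vi` and `vj`
    -- would share a color.
    · refine absurd (hPinj i hi hiT j hj hjT ?_) (by rintro rfl; exact lt_irrefl _ hij)
      rw [← hPT i hi hiT t ht, ← hPT j hj hjT t ht, hs i t, hs j t,
        (hc t (hTsub t ht) i hi h).1, (hc t (hTsub t ht) j hj (h.trans hij)).1]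
  -- Both `ia` and `ib` have the color of `vi`. Whatever the position of `i`, one of them has a
  -- lower end other than `a`, so its color differs from `κ a`.
  have hPTκ : ∀ i ∈ S.erase v, i ∉ T → ∀ a ∈ T, ∀ b ∈ T, r a < r b → col v i ≠ κ a := by
    intro i hi hiT a ha b hb hab h
    have haS := hTsub a ha
    have hbS := hTsub b hb
    have hia : i ≠ a := fun h => hiT (h ▸ ha)
    have hib : i ≠ b := fun h => hiT (h ▸ hb)
    have hlow : ∀ w ∈ S.erase v, r i < r w → κ i ≠ κ a := fun w hw hiw h =>
      hia (hκ i hi w hw a haS b hbS hiw hab h)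
    rcases lt_or_gt_of_ne (fun h => hia (hri hi haS h)) with h' | h'
    · exact hlow a haS h' (by rw [← (hc i hi a haS h').1, hPT i hi hiT a ha, h])
    · rcases lt_or_gt_of_ne (fun h => hib (hri hi hbS h)) with h'' | h''
      · exact hlow b hbS h'' (by rw [← (hc i hi b hbS h'').1, hPT i hi hiT b hb, h])
      · have := hκ b hbS i hi a haS b hbS h'' hab
          (by rw [← (hc b hbS i hi h'').1, hs, hPT i hi hiT b hb, h])
        subst this
        exact lt_irrefl _ hab
  obtain ⟨M, hM⟩ : ∃ M, ∀ i ∈ S, r i < M :=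
    ⟨S.sup r + 1, fun i hi => Nat.lt_succ_of_le (le_sup hi)⟩
  have hvT : v ∉ T := fun h => ne_of_mem_erase (hTsub v h) rfl
  let r' : V → ℕ := fun u => if u = v then M else if u ∈ T then r u + M + 1 else r u
  -- Outside `T` the value is `col v u` rather than `κ u`: the old top vertex may lie there, and `κ`
  -- is unconstrained at the top.
  let κ' : V → Option K := fun u => if u = v then col v t else if u ∈ T then κ u else col v u
  have hr'v : r' v = M := by simp [r']
  have hr'T : ∀ a ∈ T, r' a = r a + M + 1 := fun a ha => by
    simp [r', ha, ne_of_mem_erase (hTsub a ha)]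
  have hr'P : ∀ i ∈ S.erase v, i ∉ T → r' i = r i := fun i hi hiT => by
    simp [r', hiT, ne_of_mem_erase hi]
  have hκ'v : κ' v = col v t := by simp [κ']
  have hκ'T : ∀ a ∈ T, κ' a = κ a := fun a ha => by
    simp [κ', ha, ne_of_mem_erase (hTsub a ha)]
  have hκ'P : ∀ i ∈ S.erase v, i ∉ T → κ' i = col v i := fun i hi hiT => by
    simp [κ', hiT, ne_of_mem_erase hi]
  have hcases : ∀ u ∈ S, u = v ∨ u ∈ T ∨ (u ∈ S.erase v ∧ u ∉ T) := by
    intro u hu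
    by_cases h : u = v
    · exact Or.inl h
    · by_cases h' : u ∈ T
      · exact Or.inr (Or.inl h')
      · exact Or.inr (Or.inr ⟨mem_erase.2 ⟨h, hu⟩, h'⟩)
  -- only private neighbors are ranked above a private neighbor
  have hTup : ∀ a ∈ T, ∀ w ∈ S, r' a < r' w → w ∈ T ∧ r a < r w := by
    intro a ha w hw h
    rw [hr'T a ha] at h
    rcases hcases w hw with rfl | hwT | ⟨hw', hwT⟩
    · rw [hr'v] at h; omega
    · rw [hr'T w hwT] at h; exact ⟨hwT, by omega⟩
    · rw [hr'P w hw' hwT] at h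
      have := hM w hw
      omega
  refine ⟨r', κ', ?_, ?_, ?_⟩
  · intro u hu w hw huw
    have hu' := hM u hu
    have hw' := hM w hw
    rcases hcases u hu with rfl | huT | ⟨huS, huT⟩ <;>
      rcases hcases w hw with rfl | hwT | ⟨hwS, hwT⟩
    · rfl
    · rw [hr'v, hr'T w hwT] at huw; omega
    · rw [hr'v, hr'P w hwS hwT] at huw; omega
    · rw [hr'v, hr'T u huT] at huw; omega
    · rw [hr'T u huT, hr'T w hwT] at huw
      exact hri (hTsub u huT) (hTsub w hwT) (by omega)
    · rw [hr'T u huT, hr'P w hwS hwT] at huw; omega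
    · rw [hr'v, hr'P u huS huT] at huw; omega
    · rw [hr'P u huS huT, hr'T w hwT] at huw; omega
    · rw [hr'P u huS huT, hr'P w hwS hwT] at huw
      exact hri huS hwS huw
  · intro u hu w hw huw
    have hw' := hM w hw
    rcases hcases u hu with rfl | huT | ⟨huS, huT⟩
    · rw [hκ'v]
      refine ⟨?_, hadj t (hTsub t ht)⟩
      rcases hcases w hw with rfl | hwT | ⟨hwS, hwT⟩
      · exact absurd huw (lt_irrefl _)
      · exact hTs w hwT
      · rw [hr'v, hr'P w hwS hwT] at huw; omega
    · obtain ⟨hwT, hlt⟩ := hTup u huT w hw huw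
      rw [hκ'T u huT]
      exact hc u (hTsub u huT) w (hTsub w hwT) hlt
    · rw [hκ'P u huS huT]
      refine ⟨?_, hadj u huS⟩
      rcases hcases w hw with rfl | hwT | ⟨hwS, hwT⟩
      · exact hs _ _
      · exact hPT u huS huT w hwT
      · rw [hr'P u huS huT, hr'P w hwS hwT] at huw
        rw [(hc u huS w hwS huw).1, hPκ u huS huT w hwS hwT huw]
  · intro u hu w hw u' hu' w' hw' huw huw' h
    rcases hcases u hu with rfl | huT | ⟨huS, huT⟩ <;>
      rcases hcases u' hu' with rfl | huT' | ⟨huS', huT'⟩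
    · rfl
    · obtain ⟨hwT, hlt⟩ := hTup u' huT' w' hw' huw'
      rw [hκ'v, hκ'T u' huT', ← (hc u' (hTsub u' huT') w' (hTsub w' hwT) hlt).1] at h
      exact absurd h.symm (hpriv u' huT' w' (hTsub w' hwT))
    · rw [hκ'v, hκ'P u' huS' huT'] at h
      exact absurd h.symm (hPne u' huS' huT')
    · obtain ⟨hwT, hlt⟩ := hTup u huT w hw huw
      rw [hκ'v, hκ'T u huT, ← (hc u (hTsub u huT) w (hTsub w hwT) hlt).1] at h
      exact absurd h (hpriv u huT w (hTsub w hwT))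
    · obtain ⟨hwT, hlt⟩ := hTup u huT w hw huw
      obtain ⟨hwT', hlt'⟩ := hTup u' huT' w' hw' huw'
      rw [hκ'T u huT, hκ'T u' huT'] at h
      exact hκ u (hTsub u huT) w (hTsub w hwT) u' (hTsub u' huT') w' (hTsub w' hwT') hlt hlt' h
    · obtain ⟨hwT, hlt⟩ := hTup u huT w hw huw
      rw [hκ'T u huT, hκ'P u' huS' huT'] at h
      exact absurd h.symm (hPTκ u' huS' huT' u huT w hwT hlt)
    · rw [hκ'v, hκ'P u huS huT] at h
      exact absurd h (hPne u huS huT)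
    · obtain ⟨hwT', hlt'⟩ := hTup u' huT' w' hw' huw'
      rw [hκ'T u' huT', hκ'P u huS huT] at h
      exact absurd h (hPTκ u huS huT u' huT' w' hwT' hlt')
    · rw [hκ'P u huS huT, hκ'P u' huS' huT'] at h
      exact hPinj u huS huT u' huS' huT' h

/-! ### The induction: bound and equality case -/

theorem sum_card_colors_le_and_isNested (hd : ∀ v, col v v = none)
    (hs : ∀ u v, col u v = col v u) (hr : RainbowFree col) (m : ℕ) :
    ∀ S : Finset V, S.card = m + 1 →
      2 * ∑ v ∈ S, (colors col S v).card + 2 ≤ (m + 1) * (m + 2) ∧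
      (2 * ∑ v ∈ S, (colors col S v).card + 2 = (m + 1) * (m + 2) → IsNested col S) := by
  induction m with
  | zero =>
    intro S hS
    obtain ⟨v, rfl⟩ := card_eq_one.1 hS
    refine ⟨by simp [colors, nbrs, filter_singleton, hd], fun _ => ⟨fun _ => 0, fun _ => none, ?_⟩⟩
    simp
  | succ m ih =>
    intro S hS
    obtain ⟨v, hv, hle⟩ := exists_card_colors_add_card_privateNbrs_le hd hs hr
      (card_pos.1 (show 0 < S.card by omega))
    obtain ⟨h1, h2⟩ := ih (S.erase v) (by rw [card_erase_of_mem hv]; omega)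
    have h3 := sum_card_colors_le hd hs hv
    have h4 : (m + 1 + 1) * (m + 1 + 2) = (m + 1) * (m + 2) + 2 * (m + 2) := by ring
    rw [h4]
    exact ⟨by omega, fun h => IsNested.of_erase hd hs hr hv (h2 (by omega)) (by omega)⟩

end

/-! ### From edge labelings to partial colorings and back -/

/-- The color of the pair `u`, `v`, or `none` if it is not an edge. -/
noncomputable def pairColor {V K : Type*} {G : SimpleGraph V} (c : G.EdgeLabeling K) (u v : V) :
    Option K :=
  if h : G.Adj u v then some (c.get u v h) else none

section

variable {V K : Type*} {G : SimpleGraph V} (c : G.EdgeLabeling K)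

theorem pairColor_of_adj {u v : V} (h : G.Adj u v) : pairColor c u v = some (c.get u v h) := by
  simp [pairColor, h]

theorem pairColor_ne_none {u v : V} : pairColor c u v ≠ none ↔ G.Adj u v := by
  unfold pairColor
  split_ifs with h <;> simp [h]

theorem pairColor_self (v : V) : pairColor c v v = none := by
  simp [pairColor]

theorem pairColor_comm (u v : V) : pairColor c u v = pairColor c v u := by
  by_cases h : G.Adj u v
  · rw [pairColor_of_adj c h, pairColor_of_adj c h.symm, c.get_comm]
  · simp [pairColor, h, G.adj_comm v u]

theorem rainbowFree_pairColor (h : ¬ HasRainbowTriangle c) : RainbowFree (pairColor c) := by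
  intro x y z hxy hyz hxz
  rw [pairColor_ne_none] at hxy hyz hxz
  rw [pairColor_of_adj c hxy, pairColor_of_adj c hyz, pairColor_of_adj c hxz]
  by_contra! hcon
  exact h ⟨x, y, z, hxy, hyz, hxz, by simpa using hcon⟩

theorem card_colors_pairColor [Fintype V] (v : V) :
    (colors (pairColor c) univ v).card = colorDegree c v := by
  rw [colorDegree, ← Set.ncard_image_of_injective _ (Option.some_injective K),
    ← Set.ncard_coe_finset]
  congr 1
  ext k
  simp only [colors, coe_image, Set.mem_image, mem_coe, mem_nbrs, mem_univ, true_and,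
    Set.mem_ofPred_eq, pairColor_ne_none]
  constructor
  · rintro ⟨w, hw, rfl⟩
    exact ⟨_, ⟨w, hw, rfl⟩, (pairColor_of_adj c hw).symm⟩
  · rintro ⟨_, ⟨w, hw, rfl⟩, rfl⟩
    exact ⟨w, hw, pairColor_of_adj c hw⟩

theorem exists_labeling_of_isNested [Fintype V] {n : ℕ} (hn : Fintype.card V = n) (hpos : 0 < n)
    (h : IsNested (pairColor c) univ) : G = ⊤ ∧
      ∃ (v : Fin n ≃ V) (σ : K → ℕ),
        Set.BijOn σ (Set.range c) (Set.Ico 1 n) ∧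
          ∀ i j : Fin n, i < j →
            ∃ h : G.Adj (v i) (v j), σ (c.get (v i) (v j) h) = (i : ℕ) + 1 := by
  obtain ⟨r, κ, hri, hc, hκ⟩ := h
  simp only [mem_univ, forall_const] at hc hκ
  have hinj : Function.Injective r := fun a b hab => hri (by simp) (by simp) hab
  have hadj : ∀ u w, r u < r w → G.Adj u w := fun u w huw => by
    rw [← pairColor_ne_none c, (hc u w huw).1]
    exact (hc u w huw).2
  obtain ⟨v, hv⟩ : ∃ v : Fin n ≃ V, ∀ i j, i < j → r (v i) < r (v j) := by
    let _ : LinearOrder V := LinearOrder.lift' r hinj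
    let e := Fintype.orderIsoFinOfCardEq V hn
    exact ⟨e.toEquiv, fun i j hij => e.strictMono hij⟩
  refine ⟨?_, v, ?_⟩
  · ext u w
    simp only [SimpleGraph.top_adj]
    refine ⟨fun h => h.ne, fun h => ?_⟩
    rcases lt_or_gt_of_ne (fun h' => h (hinj h')) with h' | h'
    · exact hadj u w h'
    · exact (hadj w u h').symm
  have hedge : ∀ i j (hij : i < j), some (c.get (v i) (v j) (hadj _ _ (hv i j hij))) = κ (v i) :=
    fun i j hij => by rw [← pairColor_of_adj, (hc _ _ (hv i j hij)).1]
  have : Nonempty (Fin n) := ⟨⟨0, hpos⟩⟩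
  -- The last index is left out: no vertex is ranked above it, so its `κ` need not be a color of any
  -- edge.
  have hfi : Set.InjOn (fun i => κ (v i)) {i : Fin n | (i : ℕ) + 1 < n} := by
    intro i hi j hj hij
    exact v.injective (hκ _ (v ⟨i + 1, hi⟩) _ (v ⟨j + 1, hj⟩)
      (hv _ _ (Fin.lt_def.2 (Nat.lt_succ_self _))) (hv _ _ (Fin.lt_def.2 (Nat.lt_succ_self _))) hij)
  let σ : K → ℕ := fun k =>
    ((Function.invFunOn (fun i => κ (v i)) {i : Fin n | (i : ℕ) + 1 < n} (some k) : Fin n) : ℕ) + 1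
  have hlt : ∀ i j : Fin n, i < j → (i : ℕ) + 1 < n := fun i j hij => by
    have := j.isLt
    have := Fin.lt_def.1 hij
    omega
  have hσ : ∀ i j (hij : i < j), σ (c.get (v i) (v j) (hadj _ _ (hv i j hij))) = (i : ℕ) + 1 := by
    intro i j hij
    simp only [σ, hedge i j hij]
    rw [hfi.leftInvOn_invFunOn (hlt i j hij)]
  have hrange : ∀ k ∈ Set.range c, ∃ i j, ∃ hij : i < j,
      k = c.get (v i) (v j) (hadj _ _ (hv i j hij)) := by
    rintro _ ⟨⟨e, he⟩, rfl⟩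
    induction e using Sym2.ind with
    | _ x y =>
      have hxy : G.Adj x y := he
      obtain ⟨i, rfl⟩ := v.surjective x
      obtain ⟨j, rfl⟩ := v.surjective y
      rcases lt_trichotomy i j with hij | rfl | hij
      · exact ⟨i, j, hij, rfl⟩
      · exact absurd hxy G.irrefl
      · exact ⟨j, i, hij, c.get_comm _ _ hxy⟩
  refine ⟨σ, ⟨?_, ?_, ?_⟩, fun i j hij => ⟨_, hσ i j hij⟩⟩
  · intro k hk
    obtain ⟨i, j, hij, rfl⟩ := hrange k hk
    rw [hσ i j hij]
    exact ⟨by omega, hlt i j hij⟩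
  · intro k hk l hl hkl
    obtain ⟨i, j, hij, rfl⟩ := hrange k hk
    obtain ⟨i', j', hij', rfl⟩ := hrange l hl
    rw [hσ i j hij, hσ i' j' hij'] at hkl
    obtain rfl : i = i' := Fin.ext (by omega)
    exact Option.some_injective K ((hedge i j hij).trans (hedge i j' hij').symm)
  · rintro m ⟨hm1, hmn⟩
    have hij : (⟨m - 1, by omega⟩ : Fin n) < ⟨m, hmn⟩ := Fin.lt_def.2 (by simp only; omega)
    refine ⟨_, ⟨⟨s(_, _), hadj _ _ (hv _ _ hij)⟩, rfl⟩, (hσ _ _ hij).trans ?_⟩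
    simp only
    omega

end

end EdgeColored

theorem mainTheorem8 {V : Type*} [Fintype V] {K : Type*} (n : ℕ) (hn : Fintype.card V = n)
    (G : SimpleGraph V) (c : G.EdgeLabeling K)
    (hsum : ((∑ v : V, EdgeColored.colorDegree c v : ℕ) : ℚ) = (n : ℚ) * ((n : ℚ) + 1) / 2 - 1)
    (hrainbow : ¬ EdgeColored.HasRainbowTriangle c) :
    G = ⊤ ∧
      ∃ (v : Fin n ≃ V) (σ : K → ℕ),
        Set.BijOn σ (Set.range c) (Set.Ico 1 n) ∧
          ∀ i j : Fin n, i < j →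
            ∃ h : G.Adj (v i) (v j), σ (c.get (v i) (v j) h) = (i : ℕ) + 1 := by
  -- With no vertices the sum would have to be `-1`.
  have hpos : 0 < n := by
    rcases Nat.eq_zero_or_pos n with rfl | h
    · have h0 : (0 : ℚ) ≤ ((∑ v : V, EdgeColored.colorDegree c v : ℕ) : ℚ) := Nat.cast_nonneg _
      rw [hsum] at h0
      norm_num at h0
    · exact h
  refine EdgeColored.exists_labeling_of_isNested c hn hpos ?_
  obtain ⟨m, rfl⟩ := Nat.exists_eq_add_of_lt hpos
  rw [zero_add] at hn hsum
  refine (EdgeColored.sum_card_colors_le_and_isNested (EdgeColored.pairColor_self c)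
    (EdgeColored.pairColor_comm c) (EdgeColored.rainbowFree_pairColor c hrainbow) m Finset.univ
    hn).2 ?_
  simp only [EdgeColored.card_colors_pairColor]
  have h : 2 * ((∑ v : V, EdgeColored.colorDegree c v : ℕ) : ℚ) + 2 =
      ((m : ℚ) + 1) * ((m : ℚ) + 2) := by
    rw [hsum]
    push_cast
    ring
  exact_mod_cast h
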